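/- Let $G$ be a locally compact Hausdorff group, and let $\sigma\colon G\to G$ be a continuous involution, i.e. a continuous map with $\sigma(xy)=\sigma(y)\sigma(x)$ and $\sigma(\sigma(x))=x$ for all $x,y\in G$. Let $\mu$ be a complex Borel measure on $G$ which is discrete (concentrated on a countable set) and has compact support, and assume that $\mu$ is $\sigma$-invariant and idempotent, that is, for every continuous $h\colon G\to\mathbb{C}$, $$\int_G h(\sigma(t))\,d\mu(t)=\int_G h(t)\,d\mu(t)\qquad\text{and}\qquad \int_G\int_G h(ts)\,d\mu(t)\,d\mu(s)=\int_G h(t)\,d\mu(t).$$ Let $\delta\ge 0$ and let $f,g\colon G\to\mathbb{C}$ be functions such that $f$ is continuous, unbounded and $\mu$-biinvariant, i.e. $\int_G f(xt)\,d\mu(t)=\int_G f(tx)\,d\mu(t)=f(x)$ for all $x\in G$, and $$\Bigl|\int_G f(xty)\,d\mu(t)+\int_G f(xt\sigma(y))\,d\mu(t)-2f(x)g(y)\Bigr|\le\delta\qquad\text{for all }x,y\in G.$$ Then $g$ satisfies the generalized d'Alembert short functional equation $$\int_G g(xty)\,d\mu(t)+\int_G g(xt\sigma(y))\,d\mu(t)=2g(x)g(y)\qquad\text{for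 all }x,y\in G,$$ where, for all $x,y\in G$, the functions $t\mapsto g(xty)$ and $t\mapsto g(xt\sigma(y))$ are integrable with respect to the total variation $|\mu|$. -/

import Mathlib

open MeasureTheory

noncomputable section

namespace ComplexMeas

/-- The integral `∫ f(t) dμ(t)` of a complex-valued function against a complex measure. -/
def integral {G : Type*} [MeasurableSpace G] (μ : ComplexMeasure G) (f : G → ℂ) : ℂ :=
  MeasureTheory.VectorMeasure.integral μ f (ContinuousLinearMap.mul ℝ ℂ)

/-- `μ` is discrete: it is concentrated on a countable set, i.e. it is a countable sum of point
masses. (In a Hausdorff space such a complex Borel measure is automatically regular.) -/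
def IsDiscrete {G : Type*} [MeasurableSpace G] (μ : ComplexMeasure G) : Prop :=
  ∃ S : Set G, S.Countable ∧ μ.variation Sᶜ = 0

/-- `μ` has compact support: its total variation vanishes off some compact set. -/
def HasCompactSupport {G : Type*} [TopologicalSpace G] [MeasurableSpace G]
    (μ : ComplexMeasure G) : Prop :=
  ∃ K : Set G, IsCompact K ∧ μ.variation Kᶜ = 0

/-- `μ = μ_σ`, where `⟨μ_σ, h⟩ = ⟨μ, h ∘ σ⟩` for every continuous `h`. -/
def IsInvariant {G : Type*} [TopologicalSpace G] [MeasurableSpace G] (σ : G → G)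
    (μ : ComplexMeasure G) : Prop :=
  ∀ h : G → ℂ, Continuous h → integral μ (fun t => h (σ t)) = integral μ h

/-- `μ ∗ μ = μ`, where `⟨μ ∗ μ, h⟩ = ∫∫ h(ts) dμ(t) dμ(s)` for every continuous `h`. -/
def IsIdempotent {G : Type*} [Mul G] [TopologicalSpace G] [MeasurableSpace G]
    (μ : ComplexMeasure G) : Prop :=
  ∀ h : G → ℂ, Continuous h →
    integral μ (fun s => integral μ (fun t => h (t * s))) = integral μ h

/-- `f` is `μ`-biinvariant: `∫ f(xt) dμ(t) = ∫ f(tx) dμ(t) = f(x)` for all `x`. -/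
def IsBiinvariant {G : Type*} [Mul G] [MeasurableSpace G] (μ : ComplexMeasure G)
    (f : G → ℂ) : Prop :=
  ∀ x : G, integral μ (fun t => f (x * t)) = f x ∧ integral μ (fun t => f (t * x)) = f x

end ComplexMeas

/-- `σ` is a continuous involution of `G`: a continuous involutive anti-automorphism. -/
structure IsContinuousInvolution {G : Type*} [Mul G] [TopologicalSpace G] (σ : G → G) : Prop where
  continuous : Continuous σ
  map_mul : ∀ x y : G, σ (x * y) = σ y * σ x
  involutive : ∀ x : G, σ (σ x) = x

end

-- Compute in `C(G, ℂ)` modulo bounded functions. A compactly supported discrete measure ν acts by h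
-- ↦ ∫ h(xt) dν(t), preserving boundedness, and σ induces an order-reversing involution ν ↦ ν*. Let
-- E be the action of μ. Integrating the inequality against ν (`mkQ_add_eq`) shows that E(ν + ν*)
-- multiplies the class of f, nonzero since f is unbounded, by 2∫ g dν. The approximate equation is
-- thus exact in the quotient.
--
-- The rest is algebra (`IsWilsonSystem.dAlembert`). If f is an eigenvector of every p + p*, then q
-- + q*, with eigenvalue b on f, acts as b on every z f (`map_add_eq`). So p(q + q*)f + (q + q*)p*f
-- = b(p + p*)f = ab f. For p = E R_x E and q = E R_y E, with R right translation, the two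
-- symmetrized products on the left have eigenvalues 2∫ g(xty) dμ(t) and 2∫ g(xtσ(y)) dμ(t).

universe u

/-! ### Algebra: eigenvalues of symmetric elements. -/

section PairsOfOperators

variable {k V W : Type*} [Field k] [AddCommGroup V] [Module k V]
  [AddCommGroup W] [Module k W]

/-- A set of pairs of operators, stable under the involution `(P, Q) ↦ (Q, P)` and under the
product `(P, Q) (P', Q') = (P P', Q' Q)`, all of which preserve the kernel of `π`, and whose
symmetric elements have the vector `f` as an eigenvector modulo the kernel of `π`. -/
structure IsWilsonSystem (π : V →ₗ[k] W) (M : AddSubgroup (Module.End k V × Module.End k V))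
    (f : V) : Prop where
  swap_mem : ∀ p ∈ M, p.swap ∈ M
  mul_mem : ∀ p ∈ M, ∀ q ∈ M, (p.1 * q.1, q.2 * p.2) ∈ M
  map_ker : ∀ p ∈ M, ∀ v, π v = 0 → π (p.1 v) = 0
  exists_eigenvalue : ∀ p ∈ M, ∃ c : k, π (p.1 f) + π (p.2 f) = c • π f
  ne_zero : π f ≠ 0

namespace IsWilsonSystem

variable {π : V →ₗ[k] W} {M : AddSubgroup (Module.End k V × Module.End k V)} {f : V}
  {p q z : Module.End k V × Module.End k V}

lemma map_eq (h : IsWilsonSystem π M f) (hp : p ∈ M) {u v : V} (huv : π u = π v) :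
    π (p.1 u) = π (p.1 v) := by
  rw [← sub_eq_zero, ← map_sub, ← map_sub]
  exact h.map_ker p hp _ (by rw [map_sub, huv, sub_self])

lemma map_eq' (h : IsWilsonSystem π M f) (hp : p ∈ M) {u v : V} (huv : π u = π v) :
    π (p.2 u) = π (p.2 v) :=
  h.map_eq (p := p.swap) (h.swap_mem p hp) huv

/-- The symmetric elements z*q + q*z and z*q* + qz add up to z*(q + q*) + (q + q*)z, which sends f
to a multiple of f. Then use z*(q + q*)f = b z*f and z*f = a f - z f. -/
lemma exists_sub_eigenvalue (h : IsWilsonSystem π M f) (hq : q ∈ M) (hz : z ∈ M) {b : k}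
    (hb : π (q.1 f) + π (q.2 f) = b • π f) :
    ∃ c : k, π (q.1 (z.1 f)) + π (q.2 (z.1 f)) = b • π (z.1 f) + c • π f := by
  obtain ⟨a, ha⟩ := h.exists_eigenvalue z hz
  have hz' := h.swap_mem z hz
  have hq' := h.swap_mem q hq
  obtain ⟨d₁, hd₁⟩ := h.exists_eigenvalue _ (h.mul_mem _ hz' _ hq)
  obtain ⟨d₂, hd₂⟩ := h.exists_eigenvalue _ (h.mul_mem _ hz' _ hq')
  simp only [Prod.fst_swap, Prod.snd_swap, Module.End.mul_apply] at hd₁ hd₂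
  have key : π (z.2 (q.1 f + q.2 f)) = π (z.2 (b • f)) :=
    h.map_eq' hz (by rw [map_add, hb, map_smul])
  simp only [map_add, map_smul] at key
  refine ⟨d₁ + d₂ - b * a, ?_⟩
  linear_combination (norm := module) hd₁ + hd₂ - key - b • ha

variable [NeZero (2 : k)]

/-- Let D = qq* - q*q, which is symmetric, and let c, c₀ be the defects of z, q in
`exists_sub_eigenvalue`. Comparing (q + q*)qz f with q(q + q*)z f expresses D z f through f and q f;
the eigenvalue of D expresses it through f and z f. Hence c q f + c₀ z f is a multiple of f. -/
lemma map_add_eq_of_notMem_span (h : IsWilsonSystem π M f) (hq : q ∈ M) (hz : z ∈ M) {b : k}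
    (hb : π (q.1 f) + π (q.2 f) = b • π f) (hqf : ∀ c : k, π (q.1 f) ≠ c • π f) :
    π (q.1 (z.1 f)) + π (q.2 (z.1 f)) = b • π (z.1 f) := by
  have hsw := h.swap_mem q hq
  have hs : (q.1 * q.2 - q.2 * q.1, q.1 * q.2 - q.2 * q.1) ∈ M :=
    M.sub_mem (h.mul_mem _ hq _ hsw) (h.mul_mem _ hsw _ hq)
  obtain ⟨e, he⟩ := h.exists_eigenvalue _ hs
  obtain ⟨c₀, hc₀⟩ := h.exists_sub_eigenvalue hq hq hb
  have main : ∀ z ∈ M, ∀ c : k,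
      π (q.1 (z.1 f)) + π (q.2 (z.1 f)) = b • π (z.1 f) + c • π f →
      ∃ d : k, c • π (q.1 f) + c₀ • π (z.1 f) = d • π f := by
    intro z hz c hc
    obtain ⟨c₁, hc₁⟩ := h.exists_sub_eigenvalue hq (h.mul_mem _ hq _ hz) hb
    obtain ⟨d, hd⟩ := h.exists_sub_eigenvalue hs hz he
    have k₁ : π (q.1 (q.1 (z.1 f) + q.2 (z.1 f))) = π (q.1 (b • z.1 f + c • f)) :=
      h.map_eq hq (by simpa only [map_add, map_smul] using hc)
    have k₀ : π (q.1 (q.1 f + q.2 f)) = π (q.1 (b • f)) :=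
      h.map_eq hq (by simpa only [map_add, map_smul] using hb)
    simp only [Module.End.mul_apply, LinearMap.sub_apply, map_sub, map_add, map_smul]
      at hd he k₁ k₀ hc₁
    have h2 : (2 : k) ≠ 0 := two_ne_zero
    -- D f = -c₀ f, and the pair (D, D) counts D twice.
    have he' : (2 * c₀ + e) • π f = 0 := by
      linear_combination (norm := module) (2 : k) • k₀ - (2 : k) • hc₀ - he
    have he0 : 2 * c₀ + e = 0 := (smul_eq_zero.mp he').resolve_right h.ne_zero
    refine ⟨c₁ + d / 2, ?_⟩
    have h2d : (2 : k) * (d / 2) = d := by field_simp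
    have : (2 : k) • (c • π (q.1 f) + c₀ • π (z.1 f) - (c₁ + d / 2) • π f) = 0 := by
      rw [show e = -(2 * c₀) by linear_combination he0] at hd
      rw [smul_sub, ← mul_smul, mul_add, h2d]
      linear_combination (norm := module) (2 : k) • hc₁ + hd - (2 : k) • k₁
    exact sub_eq_zero.mp ((smul_eq_zero.mp this).resolve_left h2)
  have zero_of : ∀ c d : k, c • π (q.1 f) = d • π f → c = 0 := by
    intro c d hcd
    by_contra hc
    apply hqf (c⁻¹ * d)
    rw [mul_smul, ← hcd, smul_smul, inv_mul_cancel₀ hc, one_smul]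
  -- With z = q the relation reads 2c₀ q f = d₀ f, forcing c₀ = 0; for general z it then forces c =
  -- 0.
  obtain ⟨d₀, hd₀⟩ := main q hq c₀ hc₀
  have hc₀0 : c₀ = 0 := by
    have := zero_of (2 * c₀) d₀ (by rw [← hd₀]; module)
    simpa [two_ne_zero] using this
  obtain ⟨c, hc⟩ := h.exists_sub_eigenvalue hq hz hb
  obtain ⟨d, hd⟩ := main z hz c hc
  rw [hc₀0, zero_smul, add_zero] at hd
  rw [hc, zero_of c d hd, zero_smul, add_zero]

/-- If q f is a multiple of f but some x f is not, then (q + x)f is not either: subtract the case of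
x from that of q + x. If there is no such x, z f itself is a multiple of f. -/
lemma map_add_eq (h : IsWilsonSystem π M f) (hq : q ∈ M) (hz : z ∈ M) {b : k}
    (hb : π (q.1 f) + π (q.2 f) = b • π f) :
    π (q.1 (z.1 f)) + π (q.2 (z.1 f)) = b • π (z.1 f) := by
  by_cases hall : ∃ x ∈ M, ∀ c : k, π (x.1 f) ≠ c • π f
  · by_cases hqf : ∀ c : k, π (q.1 f) ≠ c • π f
    · exact h.map_add_eq_of_notMem_span hq hz hb hqf
    push Not at hqf
    obtain ⟨l, hl⟩ := hqf
    obtain ⟨x, hx, hxf⟩ := hall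
    obtain ⟨a, ha⟩ := h.exists_eigenvalue x hx
    have h₁ := h.map_add_eq_of_notMem_span hx hz ha hxf
    have h₂ := h.map_add_eq_of_notMem_span (M.add_mem hq hx) hz (b := b + a)
      (by simp only [Prod.fst_add, Prod.snd_add, LinearMap.add_apply, map_add]
          linear_combination (norm := module) ha + hb)
      (fun c hc => hxf (c - l) (by
        simp only [Prod.fst_add, LinearMap.add_apply, map_add] at hc
        linear_combination (norm := module) hc - hl))
    simp only [Prod.fst_add, Prod.snd_add, LinearMap.add_apply, map_add] at h₂
    linear_combination (norm := module) h₂ - h₁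
  · push Not at hall
    obtain ⟨l, hl⟩ := hall z hz
    have hlf : π (z.1 f) = π (l • f) := by rw [hl, map_smul]
    rw [h.map_eq hq hlf, h.map_eq' hq hlf, hlf]
    simp only [map_smul]
    linear_combination (norm := module) l • hb

/-- The eigenvalues of the symmetric elements satisfy d'Alembert's short functional equation. -/
theorem dAlembert (h : IsWilsonSystem π M f) (hp : p ∈ M) (hq : q ∈ M) {a b : k}
    (ha : π (p.1 f) + π (p.2 f) = a • π f) (hb : π (q.1 f) + π (q.2 f) = b • π f) :
    (π (p.1 (q.1 f)) + π (q.2 (p.2 f))) + (π (p.1 (q.2 f)) + π (q.1 (p.2 f)))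
      = (a * b) • π f := by
  have h₁ := h.map_add_eq (z := p.swap) hq (h.swap_mem p hp) hb
  have h₂ : π (p.1 (q.1 f + q.2 f)) = π (p.1 (b • f)) :=
    h.map_eq hp (by rw [map_add, hb, map_smul])
  simp only [map_add, map_smul, Prod.fst_swap] at h₁ h₂
  linear_combination (norm := module) h₁ + h₂ + b • ha

end IsWilsonSystem

end PairsOfOperators

/-! ### Discrete complex measures as sums of point masses. -/

namespace MeasureTheory.ComplexMeasure

variable {X : Type*} [MeasurableSpace X]

instance isFiniteMeasure_variation (μ : ComplexMeasure X) :
    IsFiniteMeasure (VectorMeasure.variation μ) := by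
  have hre : IsFiniteMeasure (VectorMeasure.variation (ComplexMeasure.re μ)) := by
    rw [← SignedMeasure.totalVariation_eq_variation]; infer_instance
  have him : IsFiniteMeasure (VectorMeasure.variation (ComplexMeasure.im μ)) := by
    rw [← SignedMeasure.totalVariation_eq_variation]; infer_instance
  refine isFiniteMeasure_of_le (VectorMeasure.variation (ComplexMeasure.re μ) +
    VectorMeasure.variation (ComplexMeasure.im μ)) ?_
  refine VectorMeasure.variation_le_of_forall_enorm_le fun E _ => ?_
  have h : ‖μ E‖ₑ ≤ ‖ComplexMeasure.re μ E‖ₑ + ‖ComplexMeasure.im μ E‖ₑ := by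
    have h1 : ‖μ E‖ ≤ ‖(μ E).re‖ + ‖(μ E).im‖ := Complex.norm_le_abs_re_add_abs_im _
    have h2 : ‖μ E‖₊ ≤ ‖(μ E).re‖₊ + ‖(μ E).im‖₊ := by exact_mod_cast h1
    simp only [enorm_eq_nnnorm]
    exact_mod_cast h2
  refine h.trans ?_
  rw [Measure.add_apply]
  exact add_le_add (VectorMeasure.enorm_measure_le_variation _ _)
    (VectorMeasure.enorm_measure_le_variation _ _)

end MeasureTheory.ComplexMeasure

namespace ComplexMeas

variable {X : Type*} [MeasurableSpace X]

/-- Almost everywhere h is the sum of its restrictions to the points of S; dominated convergence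
with bound ‖h‖ integrates termwise. -/
lemma hasSum_integral [MeasurableSingletonClass X] {μ : ComplexMeasure X} {S : Set X}
    (hS : S.Countable) (hμS : μ.variation Sᶜ = 0) {h : X → ℂ} (hh : Integrable h μ.variation) :
    HasSum (fun s : S => μ {(s : X)} * h s) (integral μ h) := by
  have := hS.to_subtype
  have hae : ∀ᵐ a ∂μ.variation, a ∈ S := mem_ae_iff.mpr hμS
  have hsum : ∀ {E : Type} [NormedAddCommGroup E] (u : X → E), ∀ a ∈ S,
      HasSum (fun s : S => Set.indicator {(s : X)} u a) (u a) := by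
    intro E _ u a ha
    have := hasSum_single (f := fun s : S => Set.indicator {(s : X)} u a) ⟨a, ha⟩ (by
      intro s hs
      refine Set.indicator_of_notMem (fun has => hs (Subtype.ext ?_)) _
      exact (Set.mem_singleton_iff.mp has).symm)
    simpa using this
  have key : HasSum (fun s : S => integral μ (Set.indicator {(s : X)} h)) (integral μ h) :=
    VectorMeasure.hasSum_integral_of_dominated_convergence
    (fun s => Set.indicator {(s : X)} fun a => ‖h a‖)
    (fun s => hh.aestronglyMeasurable.indicator (measurableSet_singleton _))
    (fun s => Filter.Eventually.of_forall fun a => (norm_indicator_eq_indicator_norm h a).le)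
    (hae.mono fun a ha => (hsum _ a ha).summable)
    (hh.norm.congr (hae.mono fun a ha => (hsum (fun a => ‖h a‖) a ha).tsum_eq.symm))
    (hae.mono fun a ha => hsum h a ha)
  refine key.congr_fun fun s => ?_
  rw [integral, VectorMeasure.integral_indicator (measurableSet_singleton _),
    VectorMeasure.integral_singleton, ContinuousLinearMap.mul_apply', mul_comm]

variable [TopologicalSpace X] [BorelSpace X]

lemma integrable_of_continuous {μ : ComplexMeasure X} {K : Set X} (hK : IsCompact K)
    (hμK : μ.variation Kᶜ = 0) {h : X → ℂ} (hh : Continuous h) : Integrable h μ.variation := by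
  obtain ⟨C, hC⟩ := hK.exists_bound_of_continuousOn hh.continuousOn
  refine Integrable.of_bound hh.measurable.aestronglyMeasurable C ?_
  have hae : ∀ᵐ a ∂μ.variation, a ∈ K := mem_ae_iff.mpr hμK
  exact hae.mono hC

variable [T2Space X]

/-- A discrete complex measure with compact support integrates continuous functions as an
absolutely convergent combination of point evaluations. -/
lemma exists_integral_eq_tsum {μ : ComplexMeasure X} (hd : IsDiscrete μ)
    (hc : HasCompactSupport μ) :
    ∃ (S : Set X) (w : S → ℂ), Summable (fun s => ‖w s‖) ∧
      (∃ K : Set X, IsCompact K ∧ ∀ s : S, (s : X) ∈ K) ∧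
      ∀ h : X → ℂ, Continuous h →
        Integrable h μ.variation ∧ integral μ h = ∑' s : S, w s * h s := by
  obtain ⟨S, hS, hμS⟩ := hd
  obtain ⟨K, hK, hμK⟩ := hc
  have hSK : μ.variation (S ∩ K)ᶜ = 0 := by
    rw [Set.compl_inter]
    exact measure_union_null hμS hμK
  have hSKc : (S ∩ K).Countable := hS.mono Set.inter_subset_left
  refine ⟨S ∩ K, fun s => μ {(s : X)}, ?_, ⟨K, hK, fun s => s.2.2⟩, fun h hh => ?_⟩
  · have := (hasSum_integral hSKc hSK (integrable_const (1 : ℂ))).summable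
    simpa using this.norm
  · have hi := integrable_of_continuous hK hμK hh
    exact ⟨hi, (hasSum_integral hSKc hSK hi).tsum_eq.symm⟩

end ComplexMeas

/-! ### Fubini and continuity for absolutely summable weights on compact sets. -/

section WeightedSums

variable {ι κ : Type*} {X Y : Type*} [TopologicalSpace X] [TopologicalSpace Y]

lemma summable_mul_continuous_apply {w : ι → ℂ} (hw : Summable fun i => ‖w i‖) {p : ι → X}
    (hp : ∃ K : Set X, IsCompact K ∧ ∀ i, p i ∈ K) {h : X → ℂ} (hh : Continuous h) :
    Summable fun i => w i * h (p i) := by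
  obtain ⟨K, hK, hpK⟩ := hp
  obtain ⟨C, hC⟩ := hK.exists_bound_of_continuousOn hh.continuousOn
  refine Summable.of_norm_bounded (hw.mul_right C) fun i => ?_
  rw [norm_mul]
  exact mul_le_mul_of_nonneg_left (hC _ (hpK i)) (norm_nonneg _)

lemma exists_isCompact_prod_mem {p : ι → X} (hp : ∃ K : Set X, IsCompact K ∧ ∀ i, p i ∈ K)
    {q : κ → Y} (hq : ∃ K : Set Y, IsCompact K ∧ ∀ i, q i ∈ K) :
    ∃ K : Set (X × Y), IsCompact K ∧ ∀ a : ι × κ, (p a.1, q a.2) ∈ K := by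
  obtain ⟨K, hK, hpK⟩ := hp
  obtain ⟨L, hL, hqL⟩ := hq
  exact ⟨K ×ˢ L, hK.prod hL, fun a => ⟨hpK _, hqL _⟩⟩

lemma exists_isCompact_mem_map {p : ι → X} (hp : ∃ K : Set X, IsCompact K ∧ ∀ i, p i ∈ K)
    {φ : X → Y} (hφ : Continuous φ) : ∃ K : Set Y, IsCompact K ∧ ∀ i, φ (p i) ∈ K := by
  obtain ⟨K, hK, hpK⟩ := hp
  exact ⟨φ '' K, hK.image hφ, fun i => ⟨_, hpK i, rfl⟩⟩

lemma summable_norm_mul_norm {w : ι → ℂ} (hw : Summable fun i => ‖w i‖) {v : κ → ℂ}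
    (hv : Summable fun i => ‖v i‖) : Summable fun a : ι × κ => ‖w a.1 * v a.2‖ := by
  simpa only [norm_mul] using
    hw.mul_of_nonneg hv (fun _ => norm_nonneg _) (fun _ => norm_nonneg _)

lemma summable_prod_mul_continuous_apply {w : ι → ℂ} (hw : Summable fun i => ‖w i‖) {p : ι → X}
    (hp : ∃ K : Set X, IsCompact K ∧ ∀ i, p i ∈ K) {v : κ → ℂ} (hv : Summable fun i => ‖v i‖)
    {q : κ → Y} (hq : ∃ K : Set Y, IsCompact K ∧ ∀ i, q i ∈ K) {Φ : X → Y → ℂ}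
    (hΦ : Continuous (Function.uncurry Φ)) :
    Summable fun a : ι × κ => w a.1 * (v a.2 * Φ (p a.1) (q a.2)) := by
  simpa only [mul_assoc, Function.uncurry] using summable_mul_continuous_apply
    (summable_norm_mul_norm hw hv) (exists_isCompact_prod_mem hp hq) hΦ

lemma tsum_tsum_eq_tsum_prod {w : ι → ℂ} (hw : Summable fun i => ‖w i‖) {p : ι → X}
    (hp : ∃ K : Set X, IsCompact K ∧ ∀ i, p i ∈ K) {v : κ → ℂ} (hv : Summable fun i => ‖v i‖)
    {q : κ → Y} (hq : ∃ K : Set Y, IsCompact K ∧ ∀ i, q i ∈ K) {Φ : X → Y → ℂ}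
    (hΦ : Continuous (Function.uncurry Φ)) :
    ∑' i, w i * ∑' j, v j * Φ (p i) (q j)
      = ∑' a : ι × κ, w a.1 * v a.2 * Φ (p a.1) (q a.2) := by
  have h := summable_prod_mul_continuous_apply hw hp hv hq hΦ
  simp only [mul_assoc]
  rw [h.tsum_prod]
  exact tsum_congr fun i => tsum_mul_left.symm

lemma tsum_mul_tsum_comm {w : ι → ℂ} (hw : Summable fun i => ‖w i‖) {p : ι → X}
    (hp : ∃ K : Set X, IsCompact K ∧ ∀ i, p i ∈ K) {v : κ → ℂ} (hv : Summable fun i => ‖v i‖)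
    {q : κ → Y} (hq : ∃ K : Set Y, IsCompact K ∧ ∀ i, q i ∈ K) {Φ : X → Y → ℂ}
    (hΦ : Continuous (Function.uncurry Φ)) :
    ∑' i, w i * ∑' j, v j * Φ (p i) (q j) = ∑' j, v j * ∑' i, w i * Φ (p i) (q j) := by
  have h := summable_prod_mul_continuous_apply hw hp hv hq hΦ
  simp only [← tsum_mul_left]
  rw [← Summable.tsum_comm (f := fun i j => w i * (v j * Φ (p i) (q j)))]
  · exact tsum_congr fun i => tsum_congr fun j => by ring
  · exact h

lemma continuous_tsum_mul_apply [WeaklyLocallyCompactSpace X] {v : κ → ℂ}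
    (hv : Summable fun i => ‖v i‖) {q : κ → Y} (hq : ∃ K : Set Y, IsCompact K ∧ ∀ i, q i ∈ K)
    {Φ : X → Y → ℂ} (hΦ : Continuous (Function.uncurry Φ)) :
    Continuous fun x => ∑' j, v j * Φ x (q j) := by
  obtain ⟨K, hK, hqK⟩ := hq
  rw [continuous_iff_continuousAt]
  intro x
  obtain ⟨U, hU, hxU⟩ := exists_compact_mem_nhds x
  obtain ⟨C, hC⟩ := (hU.prod hK).exists_bound_of_continuousOn hΦ.continuousOn
  refine ContinuousOn.continuousAt (s := U) ?_ hxU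
  refine continuousOn_tsum (u := fun j => ‖v j‖ * C) (fun j => ?_) (hv.mul_right C) ?_
  · exact (continuous_const.mul (hΦ.comp (.prodMk continuous_id continuous_const))).continuousOn
  · intro j y hy
    rw [norm_mul]
    exact mul_le_mul_of_nonneg_left (hC (y, q j) ⟨hy, hqK j⟩) (norm_nonneg _)

end WeightedSums

/-! ### Convolution operators on continuous functions. -/

section ConvolutionOperators

variable {G : Type u} [Group G] [TopologicalSpace G]

/-- The pair of operators `h ↦ ∫ h(x t) dν(t)` and `h ↦ ∫ h(x σ(t)) dν(t)` on continuous functions,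
where `ν` is the discrete measure with masses `w i` at the points `p i` of a compact set. -/
structure IsConvolutionPair (σ : G → G) {ι : Type*} (w : ι → ℂ) (p : ι → G)
    (T : Module.End ℂ C(G, ℂ) × Module.End ℂ C(G, ℂ)) : Prop where
  summable : Summable fun i => ‖w i‖
  isCompact : ∃ K : Set G, IsCompact K ∧ ∀ i, p i ∈ K
  fst_apply : ∀ (h : C(G, ℂ)) (x : G), T.1 h x = ∑' i, w i * h (x * p i)
  snd_apply : ∀ (h : C(G, ℂ)) (x : G), T.2 h x = ∑' i, w i * h (x * σ (p i))

variable (G) in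
/-- The bounded functions among the continuous ones. -/
def boundedSubmodule : Submodule ℂ C(G, ℂ) where
  carrier := {h | ∃ C : ℝ, ∀ x, ‖h x‖ ≤ C}
  add_mem' := by
    rintro a b ⟨C, hC⟩ ⟨D, hD⟩
    exact ⟨C + D, fun x => (norm_add_le _ _).trans (add_le_add (hC x) (hD x))⟩
  zero_mem' := ⟨0, fun x => by simp⟩
  smul_mem' := by
    rintro c a ⟨C, hC⟩
    refine ⟨‖c‖ * C, fun x => ?_⟩
    rw [ContinuousMap.smul_apply, norm_smul]
    exact mul_le_mul_of_nonneg_left (hC x) (norm_nonneg _)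

namespace IsConvolutionPair

variable {σ : G → G} {ι κ : Type*} {w : ι → ℂ} {p : ι → G} {v : κ → ℂ} {q : κ → G}
  {S T : Module.End ℂ C(G, ℂ) × Module.End ℂ C(G, ℂ)}

lemma swap (hσ : IsContinuousInvolution σ) (hT : IsConvolutionPair σ w p T) :
    IsConvolutionPair σ w (fun i => σ (p i)) T.swap where
  summable := hT.summable
  isCompact := exists_isCompact_mem_map hT.isCompact hσ.continuous
  fst_apply := hT.snd_apply
  snd_apply h x := by simpa only [hσ.involutive, Prod.snd_swap] using hT.fst_apply h x

lemma fst_mem_boundedSubmodule (hT : IsConvolutionPair σ w p T) {h : C(G, ℂ)}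
    (hh : h ∈ boundedSubmodule G) : T.1 h ∈ boundedSubmodule G := by
  obtain ⟨C, hC⟩ := hh
  refine ⟨∑' i, ‖w i‖ * C, fun x => ?_⟩
  rw [hT.fst_apply]
  refine tsum_of_norm_bounded (hT.summable.mul_right C).hasSum fun i => ?_
  rw [norm_mul]
  exact mul_le_mul_of_nonneg_left (hC _) (norm_nonneg _)

variable [ContinuousMul G]

lemma add (hσ : IsContinuousInvolution σ) (hS : IsConvolutionPair σ w p S)
    (hT : IsConvolutionPair σ v q T) :
    IsConvolutionPair σ (Sum.elim w v) (Sum.elim p q) (S + T) where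
  summable := by
    refine Summable.sum (f := fun i => ‖Sum.elim w v i‖) hS.summable hT.summable
  isCompact := by
    obtain ⟨K, hK, hpK⟩ := hS.isCompact
    obtain ⟨L, hL, hqL⟩ := hT.isCompact
    refine ⟨K ∪ L, hK.union hL, ?_⟩
    rintro (i | j)
    exacts [.inl (hpK i), .inr (hqL j)]
  fst_apply h x := by
    have h₁ := summable_mul_continuous_apply hS.summable hS.isCompact
      (h := fun t => h (x * t)) (by fun_prop)
    have h₂ := summable_mul_continuous_apply hT.summable hT.isCompact
      (h := fun t => h (x * t)) (by fun_prop)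
    rw [Summable.tsum_sum (f := fun i => Sum.elim w v i * h (x * Sum.elim p q i)) h₁ h₂,
      Prod.fst_add, LinearMap.add_apply, ContinuousMap.add_apply, hS.fst_apply, hT.fst_apply]
    rfl
  snd_apply h x := by
    have := hσ.continuous
    have h₁ := summable_mul_continuous_apply hS.summable hS.isCompact
      (h := fun t => h (x * σ t)) (by fun_prop)
    have h₂ := summable_mul_continuous_apply hT.summable hT.isCompact
      (h := fun t => h (x * σ t)) (by fun_prop)
    rw [Summable.tsum_sum (f := fun i => Sum.elim w v i * h (x * σ (Sum.elim p q i))) h₁ h₂,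
      Prod.snd_add, LinearMap.add_apply, ContinuousMap.add_apply, hS.snd_apply, hT.snd_apply]
    rfl

omit [ContinuousMul G] in
lemma neg (hT : IsConvolutionPair σ w p T) : IsConvolutionPair σ (fun i => -w i) p (-T) where
  summable := by simpa only [norm_neg] using hT.summable
  isCompact := hT.isCompact
  fst_apply h x := by simp [hT.fst_apply, tsum_neg]
  snd_apply h x := by simp [hT.snd_apply, tsum_neg]

lemma mul (hσ : IsContinuousInvolution σ) (hS : IsConvolutionPair σ w p S)
    (hT : IsConvolutionPair σ v q T) :
    IsConvolutionPair σ (fun a : ι × κ => w a.1 * v a.2) (fun a => p a.1 * q a.2)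
      (S.1 * T.1, T.2 * S.2) where
  summable := summable_norm_mul_norm hS.summable hT.summable
  isCompact := exists_isCompact_mem_map
    (exists_isCompact_prod_mem hS.isCompact hT.isCompact) continuous_mul
  fst_apply h x := by
    rw [Module.End.mul_apply, hS.fst_apply]
    simp only [hT.fst_apply, ← mul_assoc x]
    exact tsum_tsum_eq_tsum_prod hS.summable hS.isCompact hT.summable hT.isCompact
      (Φ := fun s t => h (x * s * t)) (by fun_prop)
  snd_apply h x := by
    have := hσ.continuous
    rw [Module.End.mul_apply, hT.snd_apply]
    simp only [hS.snd_apply, hσ.map_mul, ← mul_assoc x]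
    have hΦ : Continuous (Function.uncurry fun s t => h (x * σ t * σ s)) := by fun_prop
    -- The factors act in reverse order here, so the sums must be exchanged.
    rw [← tsum_mul_tsum_comm hS.summable hS.isCompact hT.summable hT.isCompact hΦ]
    exact tsum_tsum_eq_tsum_prod hS.summable hS.isCompact hT.summable hT.isCompact hΦ

end IsConvolutionPair

variable [ContinuousMul G]

lemma exists_end_apply_eq_tsum [WeaklyLocallyCompactSpace G] {ι : Type*} {w : ι → ℂ}
    (hw : Summable fun i => ‖w i‖) {p : ι → G} (hp : ∃ K : Set G, IsCompact K ∧ ∀ i, p i ∈ K) :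
    ∃ T : Module.End ℂ C(G, ℂ), ∀ h x, T h x = ∑' i, w i * h (x * p i) := by
  refine ⟨{ toFun := fun h => ⟨fun x => ∑' i, w i * h (x * p i),
              continuous_tsum_mul_apply hw hp (Φ := fun x t => h (x * t)) (by fun_prop)⟩
            map_add' := fun h₁ h₂ => ?_
            map_smul' := fun c h => ?_ }, fun h x => rfl⟩
  · ext x
    have hs (h : C(G, ℂ)) := summable_mul_continuous_apply hw hp
      (h := fun t => h (x * t)) (by fun_prop)
    simp [mul_add, (hs h₁).tsum_add (hs h₂)]
  · ext x
    simp only [ContinuousMap.coe_mk, ContinuousMap.smul_apply, smul_eq_mul, RingHom.id_apply,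
      ← tsum_mul_left]
    exact tsum_congr fun i => by ring

/-- Right translation `h ↦ h(· y)` as an operator on continuous functions. -/
noncomputable def rightTranslation (y : G) : Module.End ℂ C(G, ℂ) where
  toFun h := ⟨fun x => h (x * y), by fun_prop⟩
  map_add' _ _ := rfl
  map_smul' _ _ := rfl

@[simp]
lemma rightTranslation_apply (y : G) (h : C(G, ℂ)) (x : G) :
    rightTranslation y h x = h (x * y) := rfl

lemma isConvolutionPair_rightTranslation (σ : G → G) (y : G) :
    IsConvolutionPair σ (fun _ : PUnit.{u + 1} => (1 : ℂ)) (fun _ => y)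
      (rightTranslation y, rightTranslation (σ y)) where
  summable := Summable.of_finite
  isCompact := ⟨{y}, isCompact_singleton, fun _ => rfl⟩
  fst_apply h x := by simp
  snd_apply h x := by simp

/-- The pairs of convolution operators by compactly supported discrete measures which are
invariant under left multiplication by `E`. -/
def convolutionPairs (σ : G → G) (hσ : IsContinuousInvolution σ) (E : Module.End ℂ C(G, ℂ)) :
    AddSubgroup (Module.End ℂ C(G, ℂ) × Module.End ℂ C(G, ℂ)) where
  carrier := {T | (∃ (ι : Type u) (w : ι → ℂ) (p : ι → G), IsConvolutionPair σ w p T) ∧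
    E * T.1 = T.1 ∧ E * T.2 = T.2}
  add_mem' := by
    rintro S T ⟨⟨ι, w, p, hS⟩, hS₁, hS₂⟩ ⟨⟨κ, v, q, hT⟩, hT₁, hT₂⟩
    exact ⟨⟨ι ⊕ κ, _, _, hS.add hσ hT⟩, by rw [Prod.fst_add, mul_add, hS₁, hT₁],
      by rw [Prod.snd_add, mul_add, hS₂, hT₂]⟩
  zero_mem' := ⟨⟨PEmpty, PEmpty.elim, PEmpty.elim, Summable.of_finite,
    ⟨∅, isCompact_empty, fun i => i.elim⟩, fun h x => by simp, fun h x => by simp⟩,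
    mul_zero _, mul_zero _⟩
  neg_mem' := by
    rintro T ⟨⟨κ, v, q, hT⟩, hT₁, hT₂⟩
    exact ⟨⟨κ, _, _, hT.neg⟩, (LinearMap.comp_neg _ _).trans (congrArg Neg.neg hT₁),
      (LinearMap.comp_neg _ _).trans (congrArg Neg.neg hT₂)⟩

end ConvolutionOperators

/-- Choosing x with ‖f x‖ > δ/ε puts A x / (2 f x) uniformly within ε of g, so g is a uniform limit
of continuous functions. -/
lemma continuous_of_norm_sub_mul_le {X Y : Type*} [TopologicalSpace Y] {f : X → ℂ} {g : Y → ℂ}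
    {A : X → Y → ℂ} {δ : ℝ} (hδ : 0 ≤ δ) (hf : ¬ ∃ C : ℝ, ∀ x, ‖f x‖ ≤ C)
    (hA : ∀ x, Continuous (A x)) (h : ∀ x y, ‖A x y - 2 * f x * g y‖ ≤ δ) : Continuous g := by
  refine continuous_of_uniform_approx_of_continuous fun U hU => ?_
  obtain ⟨ε, hε, hεU⟩ := Metric.mem_uniformity_dist.mp hU
  push Not at hf
  obtain ⟨x, hx⟩ := hf (δ / ε)
  have hx0 : 0 < ‖f x‖ := (div_nonneg hδ hε.le).trans_lt hx
  have hfx : f x ≠ 0 := norm_pos_iff.mp hx0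
  refine ⟨fun y => A x y / (2 * f x), (hA x).div_const _, fun y => hεU ?_⟩
  have hsub : A x y / (2 * f x) - g y = (A x y - 2 * f x * g y) / (2 * f x) := by field_simp
  rw [dist_comm, dist_eq_norm, hsub, norm_div, norm_mul, Complex.norm_ofNat,
    div_lt_iff₀ (by positivity)]
  rw [div_lt_iff₀ hε] at hx
  nlinarith [h x y]

/-! ### From the approximate equation to d'Alembert's equation. -/

section ApproximateWilson

variable {G : Type u} [Group G] [TopologicalSpace G] [ContinuousMul G]
  {σ : G → G} {ι : Type*} {w : ι → ℂ} {p : ι → G}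
  {E : Module.End ℂ C(G, ℂ)} {f : C(G, ℂ)} {g : G → ℂ} {δ : ℝ}

/-- If `E f(x y) + E f(x σ(y)) - 2 f(x) g(y)` is bounded, then the symmetric elements
`ν + σ(ν)` multiply `f` by `2 ∫ g dν`, up to a bounded function. -/
lemma IsConvolutionPair.mkQ_add_eq (hσ : IsContinuousInvolution σ)
    (hE : IsConvolutionPair σ w p (E, E)) (hg : Continuous g)
    (hfg : ∀ x y, ‖E (rightTranslation y f) x + E (rightTranslation (σ y) f) x
      - 2 * f x * g y‖ ≤ δ)
    {κ : Type*} {v : κ → ℂ} {q : κ → G} {T : Module.End ℂ C(G, ℂ) × Module.End ℂ C(G, ℂ)}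
    (hT : IsConvolutionPair σ v q T) :
    (boundedSubmodule G).mkQ (E (T.1 f)) + (boundedSubmodule G).mkQ (E (T.2 f))
      = (2 * ∑' j, v j * g (q j)) • (boundedSubmodule G).mkQ f := by
  rw [← sub_eq_zero, ← map_add, ← map_smul, ← map_sub, Submodule.mkQ_apply,
    Submodule.Quotient.mk_eq_zero]
  have hσc := hσ.continuous
  -- The integrated error is at most δ times the total mass of ν.
  refine ⟨∑' j, ‖v j‖ * δ, fun x => ?_⟩
  have h₁ : E (T.1 f) x = ∑' j, v j * E (rightTranslation (q j) f) x := by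
    simp only [hE.fst_apply, hT.fst_apply, rightTranslation_apply]
    exact tsum_mul_tsum_comm hE.summable hE.isCompact hT.summable hT.isCompact
      (Φ := fun s t => f (x * s * t)) (by fun_prop)
  have h₂ : E (T.2 f) x = ∑' j, v j * E (rightTranslation (σ (q j)) f) x := by
    simp only [hE.fst_apply, hT.snd_apply, rightTranslation_apply]
    exact tsum_mul_tsum_comm hE.summable hE.isCompact hT.summable hT.isCompact
      (Φ := fun s t => f (x * s * σ t)) (by fun_prop)
  have hs₁ : Summable fun j => v j * E (rightTranslation (q j) f) x := by
    have := (summable_prod_mul_continuous_apply hT.summable hT.isCompact hE.summable hE.isCompact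
      (Φ := fun t s => f (x * s * t)) (by fun_prop)).prod
    simpa only [tsum_mul_left, hE.fst_apply, rightTranslation_apply] using this
  have hs₂ : Summable fun j => v j * E (rightTranslation (σ (q j)) f) x := by
    have := (summable_prod_mul_continuous_apply hT.summable hT.isCompact hE.summable hE.isCompact
      (Φ := fun t s => f (x * s * σ t)) (by fun_prop)).prod
    simpa only [tsum_mul_left, hE.fst_apply, rightTranslation_apply] using this
  have hsg := summable_mul_continuous_apply hT.summable hT.isCompact hg
  have key : (E (T.1 f) + E (T.2 f) - (2 * ∑' j, v j * g (q j)) • f) x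
      = ∑' j, v j * (E (rightTranslation (q j) f) x + E (rightTranslation (σ (q j)) f) x
        - 2 * f x * g (q j)) := by
    rw [ContinuousMap.sub_apply, ContinuousMap.add_apply, ContinuousMap.smul_apply, h₁, h₂,
      ← hs₁.tsum_add hs₂, smul_eq_mul, ← tsum_mul_left, ← tsum_mul_right,
      ← (hs₁.add hs₂).tsum_sub ((hsg.mul_left 2).mul_right _)]
    exact tsum_congr fun j => by ring
  rw [key]
  refine tsum_of_norm_bounded (hT.summable.mul_right δ).hasSum fun j => ?_
  rw [norm_mul]
  exact mul_le_mul_of_nonneg_left (hfg _ _) (norm_nonneg _)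

/-- Superstability of Wilson's equation: if `E` is convolution by an idempotent `σ`-invariant
discrete measure and `E f(x y) + E f(x σ(y)) - 2 f(x) g(y)` is bounded while `f = E f` is not,
then `g` solves d'Alembert's short equation. -/
theorem tsum_add_tsum_eq_of_approximate_wilson {ι : Type u} {w : ι → ℂ} {p : ι → G}
    (hσ : IsContinuousInvolution σ) (hE : IsConvolutionPair σ w p (E, E)) (hEE : E * E = E)
    (hEf : E f = f) (hf : f ∉ boundedSubmodule G) (hg : Continuous g)
    (hfg : ∀ x y, ‖E (rightTranslation y f) x + E (rightTranslation (σ y) f) x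
      - 2 * f x * g y‖ ≤ δ) (x y : G) :
    ∑' i, w i * g (x * p i * y) + ∑' i, w i * g (x * p i * σ y) = 2 * g x * g y := by
  set π := (boundedSubmodule G).mkQ
  have hπf : π f ≠ 0 := by
    rwa [Ne, Submodule.mkQ_apply, Submodule.Quotient.mk_eq_zero]
  have hsys : IsWilsonSystem π (convolutionPairs σ hσ E) f :=
    { swap_mem := by
        rintro T ⟨⟨κ, v, q, hT⟩, hT₁, hT₂⟩
        exact ⟨⟨κ, v, _, hT.swap hσ⟩, hT₂, hT₁⟩
      mul_mem := by
        rintro S ⟨⟨κ, v, q, hS⟩, hS₁, hS₂⟩ T ⟨⟨κ', v', q', hT⟩, hT₁, hT₂⟩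
        exact ⟨⟨κ × κ', _, _, hS.mul hσ hT⟩, by rw [← mul_assoc, hS₁], by rw [← mul_assoc, hT₂]⟩
      map_ker := by
        rintro T ⟨⟨κ, v, q, hT⟩, -, -⟩ h hh
        rw [Submodule.mkQ_apply, Submodule.Quotient.mk_eq_zero] at hh ⊢
        exact hT.fst_mem_boundedSubmodule hh
      exists_eigenvalue := by
        rintro T ⟨⟨κ, v, q, hT⟩, hT₁, hT₂⟩
        have := hE.mkQ_add_eq hσ hg hfg hT
        -- Left invariance absorbs the E in front.
        rw [← Module.End.mul_apply, ← Module.End.mul_apply, hT₁, hT₂] at this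
        exact ⟨_, this⟩
      ne_zero := hπf }
  have hEE' (h : C(G, ℂ)) : E (E h) = E h := congrArg (fun T : Module.End ℂ C(G, ℂ) => T h) hEE
  have hmem (z : G) : (E * rightTranslation z * E, E * (rightTranslation (σ z) * E))
      ∈ convolutionPairs σ hσ E :=
    ⟨⟨_, _, _, (hE.mul hσ (isConvolutionPair_rightTranslation σ z)).mul hσ hE⟩,
      by rw [← mul_assoc, ← mul_assoc, hEE], by rw [← mul_assoc, hEE]⟩
  have heig (z : G) : π ((E * rightTranslation z * E) f)
      + π ((E * (rightTranslation (σ z) * E)) f) = (2 * g z) • π f := by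
    have := hE.mkQ_add_eq hσ hg hfg (isConvolutionPair_rightTranslation σ z)
    simpa [hEf, π] using this
  -- Membership in `convolutionPairs` is not needed: `mkQ_add_eq` itself supplies the E in front,
  -- giving the products E R_x E R_z.
  have hpair (z : G) : IsConvolutionPair σ w (fun i => x * p i * z)
      (rightTranslation x * E * rightTranslation z,
        rightTranslation (σ z) * (E * rightTranslation (σ x))) :=
    { summable := hE.summable
      isCompact := exists_isCompact_mem_map hE.isCompact (φ := fun t => x * t * z) (by fun_prop)
      fst_apply := fun h t => by simp [hE.fst_apply, mul_assoc]
      snd_apply := fun h t => by simp [hE.snd_apply (rightTranslation (σ x) h), hσ.map_mul,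
        mul_assoc] }
  have h₁ := hE.mkQ_add_eq hσ hg hfg (hpair y)
  have h₂ := hE.mkQ_add_eq hσ hg hfg (hpair (σ y))
  have h₃ := hsys.dAlembert (hmem x) (hmem y) (heig x) (heig y)
  simp only [Module.End.mul_apply, hEE', hEf, hσ.involutive] at h₁ h₂ h₃
  have h₄ : (2 * (∑' i, w i * g (x * p i * y) + ∑' i, w i * g (x * p i * σ y))
      - 2 * g x * (2 * g y)) • π f = 0 := by
    linear_combination (norm := module) h₃ - h₁ - h₂
  linear_combination (1 / 2 : ℂ) * (smul_eq_zero.mp h₄).resolve_right hπf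

end ApproximateWilson

theorem theorem2p3 {G : Type*} [Group G] [TopologicalSpace G] [IsTopologicalGroup G]
    [LocallyCompactSpace G] [T2Space G] [MeasurableSpace G] [BorelSpace G]
    (σ : G → G) (hσ : IsContinuousInvolution σ)
    (μ : ComplexMeasure G) (hμ_disc : ComplexMeas.IsDiscrete μ)
    (hμ_supp : ComplexMeas.HasCompactSupport μ)
    (hμ_inv : ComplexMeas.IsInvariant σ μ) (hμ_idem : ComplexMeas.IsIdempotent μ)
    (δ : ℝ) (hδ : 0 ≤ δ) (f g : G → ℂ)
    (hf_cont : Continuous f) (hf_biinv : ComplexMeas.IsBiinvariant μ f)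
    (hf_unbdd : ¬ ∃ C : ℝ, ∀ x : G, ‖f x‖ ≤ C)
    (hfg : ∀ x y : G,
      ‖ComplexMeas.integral μ (fun t => f (x * t * y))
        + ComplexMeas.integral μ (fun t => f (x * t * σ y)) - 2 * f x * g y‖ ≤ δ) :
    ∀ x y : G,
      Integrable (fun t => g (x * t * y)) μ.variation ∧
      Integrable (fun t => g (x * t * σ y)) μ.variation ∧
      ComplexMeas.integral μ (fun t => g (x * t * y))
        + ComplexMeas.integral μ (fun t => g (x * t * σ y)) = 2 * g x * g y := by
  obtain ⟨S, w, hw, hS, hint⟩ := ComplexMeas.exists_integral_eq_tsum hμ_disc hμ_supp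
  have hσc := hσ.continuous
  obtain ⟨E, hE⟩ := exists_end_apply_eq_tsum hw hS
  have hE' (h : C(G, ℂ)) (x : G) : E h x = ComplexMeas.integral μ fun t => h (x * t) :=
    (hE h x).trans (hint (fun t => h (x * t)) (by fun_prop)).2.symm
  have hpair : IsConvolutionPair σ w (fun s : S => (s : G)) (E, E) :=
    { summable := hw
      isCompact := hS
      fst_apply := hE
      snd_apply := fun h x => by
        -- Invariance of μ makes E its own σ-partner.
        rw [hE', ← hμ_inv (fun t => h (x * t)) (by fun_prop)]
        exact (hint (fun t => h (x * σ t)) (by fun_prop)).2 }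
  have hEE : E * E = E := by
    refine LinearMap.ext fun h => ContinuousMap.ext fun x => ?_
    have hΦ : Continuous (Function.uncurry fun s t => h (x * (t * s))) := by fun_prop
    rw [hE' h, ← hμ_idem (fun t => h (x * t)) (by fun_prop)]
    have hinner (s : G) : ComplexMeas.integral μ (fun t => h (x * (t * s)))
        = ∑' t : S, w t * h (x * (t * s)) := (hint (fun t => h (x * (t * s))) (by fun_prop)).2
    simp only [hinner]
    -- Idempotence has the inner variable on the left, E * E on the right; hence the exchange.
    rw [(hint _ (continuous_tsum_mul_apply hw hS hΦ)).2, tsum_mul_tsum_comm hw hS hw hS hΦ]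
    simp only [Module.End.mul_apply, hE, mul_assoc]
  have hA (x y : G) : E (rightTranslation y ⟨f, hf_cont⟩) x
      = ComplexMeas.integral μ fun t => f (x * t * y) := hE' _ _
  have hg : Continuous g := by
    refine continuous_of_norm_sub_mul_le hδ hf_unbdd (fun x => ?_) hfg
    have hc : Continuous fun y => ComplexMeas.integral μ fun t => f (x * t * y) := by
      have (y : G) := (hint (fun t => f (x * t * y)) (by fun_prop)).2
      simp only [this]
      exact continuous_tsum_mul_apply hw hS (Φ := fun y t => f (x * t * y)) (by fun_prop)
    exact hc.add (hc.comp hσc)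
  intro x y
  have h₁ := hint (fun t => g (x * t * y)) (by fun_prop)
  have h₂ := hint (fun t => g (x * t * σ y)) (by fun_prop)
  refine ⟨h₁.1, h₂.1, ?_⟩
  rw [h₁.2, h₂.2]
  refine tsum_add_tsum_eq_of_approximate_wilson hσ hpair hEE (f := ⟨f, hf_cont⟩) (δ := δ)
    ?_ hf_unbdd hg (fun x y => ?_) x y
  · exact ContinuousMap.ext fun x => (hE' _ x).trans (hf_biinv x).1
  · rw [hA, hA]
    exact hfg x y
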